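/- Throughout, operators are bounded linear operators on complex Hilbert spaces. Let $n\ge 1$ and let $$\Gamma_n=\Big\{\Big(\sum_{1\le i\le n} z_i,\ \sum_{1\le i<j\le n} z_iz_j,\ \dots,\ \prod_{i=1}^n z_i\Big) : z_1,\dots,z_n\in\mathbb C,\ |z_i|\le 1\Big\}\subset\mathbb C^n$$ be the closed symmetrized polydisc. A $\Gamma_n$-contraction on a Hilbert space $\mathcal H$ is a commuting $n$-tuple $(S_1,\dots,S_{n-1},P)$ of operators on $\mathcal H$ for which $\Gamma_n$ is a spectral set; that is, the Taylor joint spectrum of the tuple is contained in $\Gamma_n$ and $\|f(S_1,\dots,S_{n-1},P)\|\le \sup_{\Gamma_n}|f|$ for every rational function $f=p/q$ ($p,q$ polynomials, $q$ without zeros on $\Gamma_n$), where $f(S_1,\dots,S_{n-1},P)=p(S_1,\dots,S_{n-1},P)\,q(S_1,\dots,S_{n-1},P)^{-1}$. A closed subspace $\mathcal M$ of $\mathcal H$ reduces an operator $T$ if $T\mathcal M\subseteq\mathcal M$ and $T\mathcal M^{\perp}\subseteq\mathcal M^{\perp}$. A $\Gamma_n$-identity is a $\Gamma_n$-contraction with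 $P=I$. A $\Gamma_n$-contraction on $\mathcal H$ is completely non-identity if no nonzero closed subspace of $\mathcal H$ reduces $P$ and is such that $P$ equals the identity operator on it. Theorem. Let $(S_1,\dots,S_{n-1},P)$ be a $\Gamma_n$-contraction on a Hilbert space $\mathcal H$. Then 1. $\operatorname{Ker}(I-P)$ and $\overline{\operatorname{Ran}}(I-P)$ reduce $S_1,\dots,S_{n-1}$ and $P$; 2. the restriction of $(S_1,\dots,S_{n-1},P)$ to $\operatorname{Ker}(I-P)$ is a $\Gamma_n$-identity; 3. the restriction of $(S_1,\dots,S_{n-1},P)$ to $\overline{\operatorname{Ran}}(I-P)$ is a completely non-identity $\Gamma_n$-contraction. -/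

import Mathlib

open scoped TensorProduct

noncomputable section

namespace GammaN

variable {H : Type*} [NormedAddCommGroup H] [InnerProductSpace ℂ H]

/-- The symmetrization map `π_n`: the `i`-th coordinate (`i = 0, …, n - 1`) of `π_n z` is the
elementary symmetric polynomial of degree `i + 1` in `z_1, …, z_n`. -/
def symmetrization (n : ℕ) (z : Fin n → ℂ) : Fin n → ℂ := fun i =>
  ∑ J ∈ Finset.powersetCard ((i : ℕ) + 1) (Finset.univ : Finset (Fin n)), ∏ j ∈ J, z j

/-- The closed symmetrized polydisc `Γ_n = {π_n z : |z_j| ≤ 1 for all j}`. -/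
def closedSymmetrizedPolydisc (n : ℕ) : Set (Fin n → ℂ) :=
  symmetrization n '' {z | ∀ j, ‖z j‖ ≤ 1}

/-- The Koszul differential of an operator tuple `T` on `H ⊗ Λ(ℂⁿ)`:
`D_T (x ⊗ ω) = ∑ i, T_i x ⊗ (e_i ∧ ω)`. It raises the degree by one. -/
def koszul {n : ℕ} (T : Fin n → (H →L[ℂ] H)) :
    (H ⊗[ℂ] ExteriorAlgebra ℂ (Fin n → ℂ)) →ₗ[ℂ] (H ⊗[ℂ] ExteriorAlgebra ℂ (Fin n → ℂ)) :=
  ∑ i, TensorProduct.map (T i : H →ₗ[ℂ] H)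
    (LinearMap.mulLeft ℂ (ExteriorAlgebra.ι ℂ (Pi.single i 1 : Fin n → ℂ)))

/-- The Taylor joint spectrum of a (commuting) tuple `T`: the points `w` for which the Koszul
complex of `T - w` is not exact. -/
def taylorSpectrum {n : ℕ} (T : Fin n → (H →L[ℂ] H)) : Set (Fin n → ℂ) :=
  {w | ¬ LinearMap.ker (koszul fun i => T i - w i • (1 : H →L[ℂ] H)) =
    LinearMap.range (koszul fun i => T i - w i • (1 : H →L[ℂ] H))}

/-- The polynomial `p` evaluated at a tuple `T`; the ordered product is used, so that the
definition makes sense for any tuple (for commuting ones the order does not matter). -/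
def polyEval {n : ℕ} (T : Fin n → (H →L[ℂ] H)) (p : MvPolynomial (Fin n) ℂ) : H →L[ℂ] H :=
  ∑ k ∈ p.support, p.coeff k • (List.ofFn fun i => T i ^ k i).prod

/-- `K` is a spectral set for the commuting tuple `T`: the Taylor joint spectrum lies in `K` and
every rational function `f = p / q` with poles off `K` (that is, `q` has no zero on `K`)
satisfies von Neumann's inequality `‖f(T)‖ ≤ sup_K |f|`, where `f(T) = p(T) q(T)⁻¹`. -/
structure IsSpectralSet {n : ℕ} (K : Set (Fin n → ℂ)) (T : Fin n → (H →L[ℂ] H)) : Prop where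
  isCompact : IsCompact K
  commute : ∀ i j, Commute (T i) (T j)
  taylorSpectrum_subset : taylorSpectrum T ⊆ K
  isUnit_and_norm_le : ∀ p q : MvPolynomial (Fin n) ℂ, (∀ z ∈ K, MvPolynomial.eval z q ≠ 0) →
    IsUnit (polyEval T q) ∧
    ‖polyEval T p * Ring.inverse (polyEval T q)‖ ≤
      sSup ((fun z => ‖MvPolynomial.eval z p / MvPolynomial.eval z q‖) '' K)

/-- The tuple `(S_1, …, S_m, P)`, of length `n = m + 1`. -/
def tuple {m : ℕ} (S : Fin m → (H →L[ℂ] H)) (P : H →L[ℂ] H) : Fin (m + 1) → (H →L[ℂ] H) :=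
  Fin.snoc (α := fun _ => H →L[ℂ] H) S P

/-- `(S_1, …, S_{n-1}, P)` is a `Γ_n`-contraction; here `n = m + 1`. -/
def IsGammaContraction {m : ℕ} (S : Fin m → (H →L[ℂ] H)) (P : H →L[ℂ] H) : Prop :=
  IsSpectralSet (closedSymmetrizedPolydisc (m + 1)) (tuple S P)

/-- The closed subspace `M` reduces `T`: both `M` and its orthogonal complement are invariant
under `T`. -/
structure Reduces (M : Submodule ℂ H) (T : H →L[ℂ] H) : Prop where
  isClosed : IsClosed (M : Set H)
  map_mem : ∀ x ∈ M, T x ∈ M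
  map_mem_orthogonal : ∀ x ∈ Mᗮ, T x ∈ Mᗮ

/-- The restriction `T|_M` of `T` to a reducing subspace `M`. -/
def Reduces.restrict {M : Submodule ℂ H} {T : H →L[ℂ] H} (h : Reduces M T) : M →L[ℂ] M :=
  T.restrict h.map_mem

/-- `Ker (I - P)`. -/
def kerOneSub (P : H →L[ℂ] H) : Submodule ℂ H :=
  LinearMap.ker ((1 - P : H →L[ℂ] H) : H →ₗ[ℂ] H)

/-- The closure of `Ran (I - P)`. -/
def closureRanOneSub (P : H →L[ℂ] H) : Submodule ℂ H :=
  (LinearMap.range ((1 - P : H →L[ℂ] H) : H →ₗ[ℂ] H)).topologicalClosure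

/-- A `Γ_n`-identity: a `Γ_n`-contraction with `P = I`. -/
structure IsGammaIdentity {m : ℕ} (S : Fin m → (H →L[ℂ] H)) (P : H →L[ℂ] H) : Prop where
  isGammaContraction : IsGammaContraction S P
  eq_one : P = 1

/-- A completely non-identity `Γ_n`-contraction: a `Γ_n`-contraction such that `{0}` is the only
subspace that reduces `P` and on which `P` is the identity. -/
structure IsCompletelyNonIdentity {m : ℕ} (S : Fin m → (H →L[ℂ] H)) (P : H →L[ℂ] H) : Prop where
  isGammaContraction : IsGammaContraction S P
  eq_bot : ∀ M : Submodule ℂ H, Reduces M P → (∀ x ∈ M, P x = x) → M = ⊥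

end GammaN

end

/-! The last coordinate on Γ_n is a product of numbers in the closed disc, so the spectral set
inequality makes `P` a contraction. A contraction and its adjoint fix the same vectors, hence Ker(I
- P) = Ker(I - P*) = Ran(I - P)ᗮ. Both subspaces are invariant under every operator commuting with
`P` and are orthogonal complements of each other, so they reduce the whole tuple. A restriction to a
joint reducing subspace is a direct summand of the tuple, and spectral sets pass to direct summands
(`IsSummand.isSpectralSet`). -/

namespace GammaN

/-! ### Spectral sets and direct summands -/

section Compression

variable {H K : Type*} [NormedAddCommGroup H] [InnerProductSpace ℂ H]
  [NormedAddCommGroup K] [InnerProductSpace ℂ K]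

/-- The tuple `R` on `K` is a direct summand of the tuple `T` on `H`: there are contractions
`J : K → H` and `Q : H → K` with `Q J = 1` that intertwine `R` and `T`. -/
structure IsSummand {n : ℕ} (R : Fin n → (K →L[ℂ] K)) (T : Fin n → (H →L[ℂ] H))
    (J : K →L[ℂ] H) (Q : H →L[ℂ] K) : Prop where
  comp_eq : Q ∘L J = 1
  norm_incl : ‖J‖ ≤ 1
  norm_proj : ‖Q‖ ≤ 1
  incl : ∀ i, T i ∘L J = J ∘L R i
  proj : ∀ i, Q ∘L T i = R i ∘L Q

theorem pow_comp_eq {A : H →L[ℂ] H} {B : K →L[ℂ] K} {J : K →L[ℂ] H}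
    (h : A ∘L J = J ∘L B) (k : ℕ) : (A ^ k) ∘L J = J ∘L (B ^ k) := by
  induction k with
  | zero => ext; simp
  | succ k ih =>
    ext x
    have h1 := DFunLike.congr_fun h x
    have h2 := DFunLike.congr_fun ih (B x)
    simp only [ContinuousLinearMap.comp_apply] at h1 h2
    simp [pow_succ, h1, h2]

theorem prod_ofFn_comp_eq {n : ℕ} {A : Fin n → (H →L[ℂ] H)} {B : Fin n → (K →L[ℂ] K)}
    {J : K →L[ℂ] H} (h : ∀ i, A i ∘L J = J ∘L B i) :
    (List.ofFn A).prod ∘L J = J ∘L (List.ofFn B).prod := by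
  induction n with
  | zero => ext; simp
  | succ n ih =>
    ext x
    have h1 := DFunLike.congr_fun (ih fun i => h i.succ) x
    have h2 := DFunLike.congr_fun (h 0) ((List.ofFn fun i : Fin n => B i.succ).prod x)
    simp only [ContinuousLinearMap.comp_apply] at h1 h2
    simp [List.ofFn_succ, h1, h2]

theorem polyEval_comp_eq {n : ℕ} {T : Fin n → (H →L[ℂ] H)} {R : Fin n → (K →L[ℂ] K)}
    {J : K →L[ℂ] H} (h : ∀ i, T i ∘L J = J ∘L R i) (p : MvPolynomial (Fin n) ℂ) :
    polyEval T p ∘L J = J ∘L polyEval R p := by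
  have key (k : Fin n →₀ ℕ) := prod_ofFn_comp_eq fun i => pow_comp_eq (h i) (k i)
  ext x
  simp only [polyEval, ContinuousLinearMap.comp_apply, sum_apply, map_sum,
    smul_apply, map_smul]
  refine Finset.sum_congr rfl fun k _ => ?_
  rw [← ContinuousLinearMap.comp_apply, key k, ContinuousLinearMap.comp_apply]

theorem koszul_map_eq {n : ℕ} {T : Fin n → (H →L[ℂ] H)} {R : Fin n → (K →L[ℂ] K)}
    {J : K →L[ℂ] H} (h : ∀ i, T i ∘L J = J ∘L R i)
    (x : K ⊗[ℂ] ExteriorAlgebra ℂ (Fin n → ℂ)) :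
    koszul T (TensorProduct.map (J : K →ₗ[ℂ] H) LinearMap.id x) =
      TensorProduct.map (J : K →ₗ[ℂ] H) LinearMap.id (koszul R x) := by
  simp only [koszul, LinearMap.sum_apply, map_sum]
  refine Finset.sum_congr rfl fun i _ => ?_
  simp only [← LinearMap.comp_apply, ← TensorProduct.map_comp]
  congr 2
  ext y
  exact DFunLike.congr_fun (h i) y

variable {n : ℕ} {R : Fin n → (K →L[ℂ] K)} {T : Fin n → (H →L[ℂ] H)}
  {J : K →L[ℂ] H} {Q : H →L[ℂ] K}

theorem IsSummand.proj_incl (h : IsSummand R T J Q) (x : K) : Q (J x) = x :=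
  DFunLike.congr_fun h.comp_eq x

theorem IsSummand.sub_smul_one (h : IsSummand R T J Q) (w : Fin n → ℂ) :
    IsSummand (fun i => R i - w i • (1 : K →L[ℂ] K)) (fun i => T i - w i • (1 : H →L[ℂ] H)) J Q where
  comp_eq := h.comp_eq
  norm_incl := h.norm_incl
  norm_proj := h.norm_proj
  incl i := by
    ext x
    have := DFunLike.congr_fun (h.incl i) x
    simp only [ContinuousLinearMap.comp_apply] at this
    simp [this]
  proj i := by
    ext x
    have := DFunLike.congr_fun (h.proj i) x
    simp only [ContinuousLinearMap.comp_apply] at this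
    simp [this]

/-- `J ⊗ id` and `Q ⊗ id` commute with the Koszul differentials and compose to the identity, and a
retract of an exact complex is exact. -/
theorem IsSummand.ker_koszul_eq_range (h : IsSummand R T J Q)
    (hT : LinearMap.ker (koszul T) = LinearMap.range (koszul T)) :
    LinearMap.ker (koszul R) = LinearMap.range (koszul R) := by
  have hQJ (x : K ⊗[ℂ] ExteriorAlgebra ℂ (Fin n → ℂ)) :
      TensorProduct.map (Q : H →ₗ[ℂ] K) LinearMap.id
        (TensorProduct.map (J : K →ₗ[ℂ] H) LinearMap.id x) = x := by
    rw [← LinearMap.comp_apply, ← TensorProduct.map_comp]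
    have : (Q : H →ₗ[ℂ] K) ∘ₗ (J : K →ₗ[ℂ] H) = LinearMap.id := by
      ext y
      exact h.proj_incl y
    simp [this]
  ext x
  constructor
  · intro hx
    have hx' : TensorProduct.map (J : K →ₗ[ℂ] H) LinearMap.id x ∈ LinearMap.ker (koszul T) := by
      rw [LinearMap.mem_ker] at hx ⊢
      rw [koszul_map_eq h.incl, hx, map_zero]
    rw [hT] at hx'
    obtain ⟨y, hy⟩ := hx'
    refine ⟨TensorProduct.map (Q : H →ₗ[ℂ] K) LinearMap.id y, ?_⟩
    rw [koszul_map_eq fun i => (h.proj i).symm, hy, hQJ]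
  · rintro ⟨y, rfl⟩
    have hy : koszul T (TensorProduct.map (J : K →ₗ[ℂ] H) LinearMap.id y) ∈
        LinearMap.ker (koszul T) := hT ▸ ⟨_, rfl⟩
    rw [LinearMap.mem_ker, koszul_map_eq h.incl, koszul_map_eq h.incl] at hy
    rw [LinearMap.mem_ker, ← hQJ (koszul R (koszul R y)), hy, map_zero]

theorem IsSummand.taylorSpectrum_subset (h : IsSummand R T J Q) :
    taylorSpectrum R ⊆ taylorSpectrum T :=
  fun w hw hT => hw ((h.sub_smul_one w).ker_koszul_eq_range hT)

/-- Direct summands inherit spectral sets. -/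
theorem IsSummand.isSpectralSet (h : IsSummand R T J Q) {X : Set (Fin n → ℂ)}
    (hT : IsSpectralSet X T) : IsSpectralSet X R where
  isCompact := hT.isCompact
  commute i j := by
    have hR (i j : Fin n) (x : K) : R i (R j x) = Q (T i (T j (J x))) := by
      have h1 := DFunLike.congr_fun (h.incl j) x
      have h2 := DFunLike.congr_fun (h.proj i) (J (R j x))
      simp only [ContinuousLinearMap.comp_apply] at h1 h2
      rw [h1, h2, h.proj_incl]
    ext x
    have := DFunLike.congr_fun (hT.commute i j) (J x)
    simp only [mul_apply_eq_comp] at this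
    simp [hR, this]
  taylorSpectrum_subset := h.taylorSpectrum_subset.trans hT.taylorSpectrum_subset
  isUnit_and_norm_le p q hq := by
    obtain ⟨hu, hle⟩ := hT.isUnit_and_norm_le p q hq
    have hJ (p : MvPolynomial (Fin n) ℂ) (x : K) : polyEval T p (J x) = J (polyEval R p x) :=
      DFunLike.congr_fun (polyEval_comp_eq h.incl p) x
    have hQ (p : MvPolynomial (Fin n) ℂ) (x : H) : polyEval R p (Q x) = Q (polyEval T p x) :=
      DFunLike.congr_fun (polyEval_comp_eq (fun i => (h.proj i).symm) p) x
    set A : H →L[ℂ] H := Ring.inverse (polyEval T q) with hA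
    have hA1 (x : H) : polyEval T q (A x) = x :=
      DFunLike.congr_fun (Ring.mul_inverse_cancel _ hu) x
    have hA2 (x : H) : A (polyEval T q x) = x :=
      DFunLike.congr_fun (Ring.inverse_mul_cancel _ hu) x
    -- The inverse of `q(R)` is the compression of `q(T)⁻¹`; the intertwining relations and `Q J =
    -- 1` make it two-sided.
    let u : (K →L[ℂ] K)ˣ :=
      { val := polyEval R q
        inv := Q ∘L A ∘L J
        val_inv := by
          ext x
          simp [hQ, hA1, h.proj_incl]
        inv_val := by
          ext x
          simp [← hJ, hA2, h.proj_incl] }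
    have hinv : Ring.inverse (polyEval R q) = Q ∘L A ∘L J := Ring.inverse_unit u
    refine ⟨u.isUnit, le_trans ?_ hle⟩
    have hcomp : polyEval R p * Ring.inverse (polyEval R q) = Q ∘L (polyEval T p * A) ∘L J := by
      ext x
      simp [hinv, hQ]
    rw [hcomp]
    calc ‖Q ∘L (polyEval T p * A) ∘L J‖
        ≤ ‖Q‖ * (‖polyEval T p * A‖ * ‖J‖) :=
          (ContinuousLinearMap.opNorm_comp_le _ _).trans
            (mul_le_mul_of_nonneg_left (ContinuousLinearMap.opNorm_comp_le _ _) (norm_nonneg _))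
      _ ≤ 1 * (‖polyEval T p * A‖ * 1) := by
          gcongr
          · exact h.norm_proj
          · exact h.norm_incl
      _ = ‖polyEval T p * A‖ := by ring

end Compression

/-! ### Reducing subspaces of a Γ_n-contraction -/

section Reducing

variable {H : Type*} [NormedAddCommGroup H] [InnerProductSpace ℂ H]

theorem Reduces.orthogonalProjection_apply {M : Submodule ℂ H} [M.HasOrthogonalProjection]
    {T : H →L[ℂ] H} (h : Reduces M T) (x : H) :
    M.orthogonalProjectionOnto (T x) = h.restrict (M.orthogonalProjectionOnto x) := by
  have hx : T x = T (M.orthogonalProjectionOnto x : H) + T (x - M.orthogonalProjectionOnto x) := by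
    rw [← map_add, add_sub_cancel]
  have h0 : M.orthogonalProjectionOnto (T (x - M.orthogonalProjectionOnto x)) = 0 :=
    Submodule.orthogonalProjectionOnto_apply_of_mem_orthogonal
      (h.map_mem_orthogonal _ (M.sub_starProjection_mem_orthogonal x))
  rw [hx, map_add, h0, add_zero]
  exact M.orthogonalProjectionOnto_mem_subspace_eq_self (h.restrict (M.orthogonalProjectionOnto x))

theorem tuple_castSucc {m : ℕ} (S : Fin m → (H →L[ℂ] H)) (P : H →L[ℂ] H) (i : Fin m) :
    tuple S P i.castSucc = S i :=
  Fin.snoc_castSucc (α := fun _ => H →L[ℂ] H) _ _ i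

theorem tuple_last {m : ℕ} (S : Fin m → (H →L[ℂ] H)) (P : H →L[ℂ] H) :
    tuple S P (Fin.last m) = P :=
  Fin.snoc_last (α := fun _ => H →L[ℂ] H) _ _

/-- The restriction of a `Γ_n`-contraction to a joint reducing subspace is a `Γ_n`-contraction. -/
theorem IsGammaContraction.restrict {m : ℕ} {S : Fin m → (H →L[ℂ] H)} {P : H →L[ℂ] H}
    (h : IsGammaContraction S P) {M : Submodule ℂ H} [M.HasOrthogonalProjection]
    (hS : ∀ i, Reduces M (S i)) (hP : Reduces M P) :
    IsGammaContraction (fun i => (hS i).restrict) hP.restrict := by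
  refine IsSummand.isSpectralSet (J := M.subtypeL) (Q := M.orthogonalProjectionOnto) ?_ h
  refine ⟨?_, M.norm_subtypeL_le, M.orthogonalProjectionOnto_norm_le, fun i => ?_, fun i => ?_⟩
  · ext x
    simp
  · refine Fin.lastCases ?_ (fun i => ?_) i
    · rw [tuple_last, tuple_last]; rfl
    · rw [tuple_castSucc, tuple_castSucc]; rfl
  · refine Fin.lastCases ?_ (fun i => ?_) i
    · rw [tuple_last, tuple_last]
      exact ContinuousLinearMap.ext hP.orthogonalProjection_apply
    · rw [tuple_castSucc, tuple_castSucc]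
      exact ContinuousLinearMap.ext (hS i).orthogonalProjection_apply

theorem polyEval_one {n : ℕ} (T : Fin n → (H →L[ℂ] H)) : polyEval T 1 = 1 := by
  have : (1 : MvPolynomial (Fin n) ℂ).support = {0} := by
    simp
  simp [polyEval, this]

theorem polyEval_X_last {m : ℕ} (T : Fin (m + 1) → (H →L[ℂ] H)) :
    polyEval T (MvPolynomial.X (Fin.last m)) = T (Fin.last m) := by
  simp only [polyEval, MvPolynomial.support_X, Finset.sum_singleton, MvPolynomial.coeff_X, one_smul,
    List.ofFn_succ', Finsupp.single_apply, (Fin.castSucc_lt_last _).ne', if_false, if_true,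
    pow_zero, pow_one]
  simp

theorem norm_last_le_one {m : ℕ} {z : Fin (m + 1) → ℂ}
    (hz : z ∈ closedSymmetrizedPolydisc (m + 1)) : ‖z (Fin.last m)‖ ≤ 1 := by
  obtain ⟨y, hy, rfl⟩ := hz
  have hcard : Finset.powersetCard (m + 1) (Finset.univ : Finset (Fin (m + 1))) =
      {Finset.univ} := by
    simpa using Finset.powersetCard_self (Finset.univ : Finset (Fin (m + 1)))
  simp only [symmetrization, Fin.val_last, hcard, Finset.sum_singleton, norm_prod]
  exact Finset.prod_le_one (fun _ _ => norm_nonneg _) fun j _ => hy j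

theorem IsGammaContraction.norm_le_one {m : ℕ} {S : Fin m → (H →L[ℂ] H)} {P : H →L[ℂ] H}
    (h : IsGammaContraction S P) : ‖P‖ ≤ 1 := by
  -- Von Neumann's inequality for the last coordinate function, with denominator 1.
  have := (h.isUnit_and_norm_le (MvPolynomial.X (Fin.last m)) 1 (by simp)).2
  rw [polyEval_one, polyEval_X_last, tuple_last, Ring.inverse_one, mul_one] at this
  refine this.trans (Real.sSup_le ?_ zero_le_one)
  rintro _ ⟨z, hz, rfl⟩
  simpa using norm_last_le_one hz

theorem mem_kerOneSub {P : H →L[ℂ] H} {x : H} : x ∈ kerOneSub P ↔ P x = x := by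
  simp [kerOneSub, sub_eq_zero, eq_comm (a := x)]

theorem isClosed_kerOneSub (P : H →L[ℂ] H) : IsClosed (kerOneSub P : Set H) :=
  (1 - P : H →L[ℂ] H).isClosed_ker

theorem map_mem_kerOneSub {P T : H →L[ℂ] H} (hT : Commute T P) {x : H} (hx : x ∈ kerOneSub P) :
    T x ∈ kerOneSub P := by
  rw [mem_kerOneSub] at hx ⊢
  have := DFunLike.congr_fun hT x
  simp only [mul_apply_eq_comp, hx] at this
  exact this.symm

theorem map_mem_closureRanOneSub {P T : H →L[ℂ] H} (hT : Commute T P) {x : H}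
    (hx : x ∈ closureRanOneSub P) : T x ∈ closureRanOneSub P := by
  refine map_mem_closure T.continuous hx ?_
  rintro _ ⟨y, rfl⟩
  refine ⟨T y, ?_⟩
  have := DFunLike.congr_fun hT y
  simp only [mul_apply_eq_comp] at this
  simp [this]

/-! ### Fixed vectors of a contraction -/

variable [CompleteSpace H]

/-- Since ⟨Px, x⟩ = ⟨x, P*x⟩ = ‖x‖², expanding gives ‖Px - x‖² = ‖Px‖² - ‖x‖² ≤ 0. -/
theorem apply_eq_self_of_adjoint_apply_eq_self {P : H →L[ℂ] H} (hP : ‖P‖ ≤ 1) {x : H}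
    (hx : P.adjoint x = x) : P x = x := by
  have h1 : ‖P x‖ ≤ ‖x‖ := by
    simpa using P.le_of_opNorm_le hP x
  have h2 : inner ℂ (P x) x = inner ℂ x x := by
    rw [← ContinuousLinearMap.adjoint_inner_right, hx]
  have h3 : ‖P x - x‖ ^ 2 ≤ 0 := by
    rw [norm_sub_sq (𝕜 := ℂ), h2, inner_self_eq_norm_sq (𝕜 := ℂ)]
    nlinarith [norm_nonneg (P x)]
  have h4 : ‖P x - x‖ = 0 := by nlinarith [norm_nonneg (P x - x)]
  exact sub_eq_zero.1 (norm_eq_zero.1 h4)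

theorem adjoint_apply_eq_self_iff {P : H →L[ℂ] H} (hP : ‖P‖ ≤ 1) {x : H} :
    P.adjoint x = x ↔ P x = x := by
  refine ⟨apply_eq_self_of_adjoint_apply_eq_self hP, fun hx => ?_⟩
  refine apply_eq_self_of_adjoint_apply_eq_self (P := P.adjoint) ?_ ?_
  · simpa using hP
  · simpa using hx

/-- For a contraction `P`, the orthogonal complement of the closure of `Ran (I - P)` is
`Ker (I - P)`. -/
theorem orthogonal_closureRanOneSub {P : H →L[ℂ] H} (hP : ‖P‖ ≤ 1) :
    (closureRanOneSub P)ᗮ = kerOneSub P := by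
  ext x
  rw [closureRanOneSub, Submodule.orthogonal_closure, ContinuousLinearMap.orthogonal_range,
    mem_kerOneSub, ← adjoint_apply_eq_self_iff hP]
  simp [sub_eq_zero, ContinuousLinearMap.adjoint_one, eq_comm (a := x)]

theorem orthogonal_kerOneSub {P : H →L[ℂ] H} (hP : ‖P‖ ≤ 1) :
    (kerOneSub P)ᗮ = closureRanOneSub P := by
  rw [← orthogonal_closureRanOneSub hP, Submodule.orthogonal_orthogonal_eq_closure,
    closureRanOneSub]
  exact (Submodule.isClosed_topologicalClosure _).submodule_topologicalClosure_eq

/-- The complement is the closure of Ran(I - P), again invariant under the commutant of `P`, so `T`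
need not commute with P*. -/
theorem reduces_kerOneSub {P T : H →L[ℂ] H} (hP : ‖P‖ ≤ 1) (hT : Commute T P) :
    Reduces (kerOneSub P) T where
  isClosed := isClosed_kerOneSub P
  map_mem _ := map_mem_kerOneSub hT
  map_mem_orthogonal x hx := by
    rw [orthogonal_kerOneSub hP] at hx ⊢
    exact map_mem_closureRanOneSub hT hx

theorem reduces_closureRanOneSub {P T : H →L[ℂ] H} (hP : ‖P‖ ≤ 1) (hT : Commute T P) :
    Reduces (closureRanOneSub P) T where
  isClosed := Submodule.isClosed_topologicalClosure _
  map_mem _ := map_mem_closureRanOneSub hT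
  map_mem_orthogonal x hx := by
    rw [orthogonal_closureRanOneSub hP] at hx ⊢
    exact map_mem_kerOneSub hT hx

end Reducing

end GammaN

theorem mainTheorem8 {H : Type*} [NormedAddCommGroup H] [InnerProductSpace ℂ H] [CompleteSpace H]
    {m : ℕ} (S : Fin m → (H →L[ℂ] H)) (P : H →L[ℂ] H) (h : GammaN.IsGammaContraction S P) :
    ∃ (hPK : GammaN.Reduces (GammaN.kerOneSub P) P)
      (hPR : GammaN.Reduces (GammaN.closureRanOneSub P) P)
      (hSK : ∀ i, GammaN.Reduces (GammaN.kerOneSub P) (S i))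
      (hSR : ∀ i, GammaN.Reduces (GammaN.closureRanOneSub P) (S i)),
      GammaN.IsGammaIdentity (fun i => (hSK i).restrict) hPK.restrict ∧
      GammaN.IsCompletelyNonIdentity (fun i => (hSR i).restrict) hPR.restrict := by
  have hP : ‖P‖ ≤ 1 := h.norm_le_one
  have hS (i : Fin m) : Commute (S i) P := by
    simpa only [GammaN.tuple_castSucc, GammaN.tuple_last] using
      h.commute i.castSucc (Fin.last m)
  have hPK := GammaN.reduces_kerOneSub hP (Commute.refl P)
  have hPR := GammaN.reduces_closureRanOneSub hP (Commute.refl P)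
  have hSK (i : Fin m) := GammaN.reduces_kerOneSub hP (hS i)
  have hSR (i : Fin m) := GammaN.reduces_closureRanOneSub hP (hS i)
  have : CompleteSpace (GammaN.kerOneSub P) := hPK.isClosed.completeSpace_coe
  have : CompleteSpace (GammaN.closureRanOneSub P) := hPR.isClosed.completeSpace_coe
  refine ⟨hPK, hPR, hSK, hSR, ⟨h.restrict hSK hPK, ?_⟩, ⟨h.restrict hSR hPR, ?_⟩⟩
  · ext x
    exact GammaN.mem_kerOneSub.1 x.2
  · intro M _ hM
    refine (Submodule.eq_bot_iff _).2 fun x hx => Subtype.ext ?_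
    -- Being fixed by `P`, the vector `x` is orthogonal to the subspace that contains it.
    have hker : (x : H) ∈ (GammaN.closureRanOneSub P)ᗮ := by
      rw [GammaN.orthogonal_closureRanOneSub hP, GammaN.mem_kerOneSub]
      exact congrArg Subtype.val (hM x hx)
    exact inner_self_eq_zero.1 (hker x x.2)
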